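/- Let $\mathrm{Ai}$ denote the Airy function, i.e. the entire function with $\mathrm{Ai}(x)=\lim_{R\to\infty}\frac1{2\pi}\int_{-R}^{R}e^{i(k^3/3+kx)}\,dk$ for real $x$. For $a<b$ write $S(a,b)=\{re^{i\theta}: r>0,\ a<\theta<b\}$, and let $S=S(-\pi/2,3\pi/2)$. For $\eta\in\mathbb{C}\setminus\{0\}$ with (principal) argument $\arg\eta\in(-\pi/2,\pi/6)$ put $w=\eta^2$ and $\zeta=2\eta^3/3$, so that $\zeta^{-1}\in S$, and let $\sqrt\eta$ be the principal square root. Then there is an analytic function $J:S\to\mathbb{C}$ such that $$J(\zeta^{-1})=\sqrt{\eta}\,e^{2\eta^3/3}\,\mathrm{Ai}(w)\qquad\text{for all } \eta\ne 0 \text{ with } \arg\eta\in(-\pi/2,\pi/6).$$ Moreover there are complex numbers $c_0,c_1,c_2,\dots$ such that for every $\delta>0$ and every $m\ge 0$: (i) $J$ and all its derivatives extend continuously to the origin in $S(-\pi/2,3\pi/2-\delta)$: $J^{(m)}(z)\to m!\,c_m$ as $z\to0$, $z\in S(-\pi/2,3\pi/2-\delta)$; (ii) $J(z)\sim\sum_{n\ge0}c_nz^n$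 as $z\to 0$ in $S(-\pi/2,3\pi/2-\delta)$, and this asymptotic expansion can be differentiated term by term any number of times: for every $N\ge0$, $$J^{(m)}(z)-\frac{d^m}{dz^m}\sum_{n=0}^{N+m-1}c_nz^n=O(z^{N})\qquad (z\to0,\ z\in S(-\pi/2,3\pi/2-\delta)).$$ The numbers $c_n$ do not depend on $\delta$. -/

import Mathlib

open Filter Topology

/-- The integrand `e^{i(s³/3 + s w)}` of the Airy integral. -/
noncomputable def airyIntegrand (w s : ℂ) : ℂ :=
  Complex.exp (Complex.I * (s ^ 3 / 3 + s * w))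

/-- The Airy function on the complex plane, `Ai(w) = (2π)⁻¹ ∫ e^{i(s³/3 + s w)} ds`, the integral
being taken over the line `s = t + i`, `t ∈ ℝ`, where it converges absolutely for every complex `w`.
By `differentiable_airyAi` and `tendsto_airyAi` below this is the entire function which on the real
axis is given by the usual (conditionally convergent) integral over the real line. -/
noncomputable def airyAi (w : ℂ) : ℂ :=
  (2 * (Real.pi : ℂ))⁻¹ * ∫ t : ℝ, airyIntegrand w ((t : ℂ) + Complex.I)

/-- The open sector `{r e^{iθ} : r > 0, a < θ < b}`. -/
def sector (a b : ℝ) : Set ℂ :=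
  {z | ∃ r θ : ℝ, 0 < r ∧ a < θ ∧ θ < b ∧ z = (r : ℂ) * Complex.exp ((θ : ℂ) * Complex.I)}

theorem norm_airyIntegrand (w : ℂ) (t y : ℝ) :
    ‖airyIntegrand w ((t : ℂ) + (y : ℂ) * Complex.I)‖ =
      Real.exp (-(t ^ 2 * y) + y ^ 3 / 3 - t * w.im - y * w.re) := by
  rw [airyIntegrand, Complex.norm_exp]
  congr 1
  have h : ((t : ℂ) + (y : ℂ) * Complex.I) ^ 3 / 3
      = ((t ^ 3 / 3 - t * y ^ 2 : ℝ) : ℂ) + ((t ^ 2 * y - y ^ 3 / 3 : ℝ) : ℂ) * Complex.I := by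
    push_cast
    linear_combination ((t : ℂ) * y ^ 2 + (y : ℂ) ^ 3 / 3 * Complex.I) * Complex.I_sq
  rw [h]
  simp only [Complex.mul_re, Complex.add_re, Complex.add_im, Complex.mul_im, Complex.I_re,
    Complex.I_im, Complex.ofReal_re, Complex.ofReal_im]
  ring

theorem norm_airyIntegrand_le (w : ℂ) {M : ℝ} (hw : ‖w‖ ≤ M) (t : ℝ) :
    ‖airyIntegrand w ((t : ℂ) + Complex.I)‖ ≤
      Real.exp (1 / 3 + M + M ^ 2 / 2) * Real.exp (-(1 / 2) * t ^ 2) := by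
  have h := norm_airyIntegrand w t 1
  simp only [Complex.ofReal_one, one_mul] at h
  rw [h, ← Real.exp_add]
  apply Real.exp_le_exp.mpr
  have h1 := (abs_le.mp ((Complex.abs_re_le_norm w).trans hw)).1
  have h2 := abs_le.mp ((Complex.abs_im_le_norm w).trans hw)
  have h3 : w.im ^ 2 ≤ M ^ 2 := by nlinarith [h2.1, h2.2]
  nlinarith [sq_nonneg (t + w.im)]

theorem continuous_airyIntegrand (w : ℂ) : Continuous (airyIntegrand w) := by
  unfold airyIntegrand
  fun_prop

theorem integrable_airyIntegrand (w : ℂ) :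
    MeasureTheory.Integrable (fun t : ℝ => airyIntegrand w ((t : ℂ) + Complex.I)) := by
  refine MeasureTheory.Integrable.mono' ((integrable_exp_neg_mul_sq (b := 1 / 2)
    (by norm_num)).const_mul (Real.exp (1 / 3 + ‖w‖ + ‖w‖ ^ 2 / 2))) ?_
    (Eventually.of_forall (norm_airyIntegrand_le w le_rfl))
  exact ((continuous_airyIntegrand w).comp (by fun_prop)).aestronglyMeasurable

/-- The Airy function is entire. -/
theorem differentiable_airyAi : Differentiable ℂ airyAi := by
  intro w₀
  unfold airyAi
  refine DifferentiableAt.const_mul ?_ _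
  set K : ℝ := Real.exp (1 / 3 + (‖w₀‖ + 1) + (‖w₀‖ + 1) ^ 2 / 2)
  have key := hasDerivAt_integral_of_dominated_loc_of_deriv_le
    (μ := MeasureTheory.volume) (𝕜 := ℂ)
    (F := fun w (t : ℝ) => airyIntegrand w ((t : ℂ) + Complex.I))
    (F' := fun w (t : ℝ) => airyIntegrand w ((t : ℂ) + Complex.I) *
      (Complex.I * ((t : ℂ) + Complex.I)))
    (x₀ := w₀) (s := Metric.ball w₀ 1)
    (bound := fun t : ℝ => K * (|t| * Real.exp (-(1 / 2) * t ^ 2)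
      + Real.exp (-(1 / 2) * t ^ 2)))
    (Metric.ball_mem_nhds w₀ one_pos)
    (Eventually.of_forall fun w =>
      ((continuous_airyIntegrand w).comp (by fun_prop)).aestronglyMeasurable)
    (integrable_airyIntegrand w₀)
    (((continuous_airyIntegrand w₀).comp (by fun_prop)).mul
      (by fun_prop)).aestronglyMeasurable ?_ ?_ ?_
  · exact key.2.differentiableAt
  · refine Eventually.of_forall fun t w hw => ?_
    have hw' : ‖w‖ ≤ ‖w₀‖ + 1 := by
      have h1 : ‖w - w₀‖ < 1 := by simpa [dist_eq_norm] using hw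
      have h2 := norm_add_le (w - w₀) w₀
      rw [sub_add_cancel] at h2
      linarith
    have h3 : ‖Complex.I * ((t : ℂ) + Complex.I)‖ ≤ |t| + 1 := by
      rw [norm_mul, Complex.norm_I, one_mul]
      refine (norm_add_le _ _).trans ?_
      simp
    rw [norm_mul]
    calc _ ≤ (K * Real.exp (-(1 / 2) * t ^ 2)) * (|t| + 1) :=
          mul_le_mul (norm_airyIntegrand_le w hw' t) h3 (norm_nonneg _) (by positivity)
      _ = _ := by ring
  · refine MeasureTheory.Integrable.const_mul (MeasureTheory.Integrable.add ?_
      (integrable_exp_neg_mul_sq (by norm_num))) _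
    have h := (integrable_mul_exp_neg_mul_sq (b := 1 / 2) (by norm_num)).norm
    simpa [abs_mul, Real.abs_exp] using h
  · refine Eventually.of_forall fun t w _ => ?_
    have h : HasDerivAt (fun w : ℂ => Complex.I *
        (((t : ℂ) + Complex.I) ^ 3 / 3 + ((t : ℂ) + Complex.I) * w))
        (Complex.I * ((t : ℂ) + Complex.I)) w := by
      simpa using (((hasDerivAt_id w).const_mul ((t : ℂ) + Complex.I)).const_add
        (((t : ℂ) + Complex.I) ^ 3 / 3)).const_mul Complex.I
    exact h.cexp

/-- The vertical sides of the rectangle between the lines `Im s = 0` and `Im s = 1` do not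
contribute in the limit. -/
theorem tendsto_airy_side (x : ℝ) {u : ℝ → ℝ} (hu : ∀ R, u R ^ 2 = R ^ 2) :
    Tendsto (fun R : ℝ => ∫ y in (0 : ℝ)..1,
      airyIntegrand x ((u R : ℂ) + (y : ℂ) * Complex.I)) atTop (𝓝 0) := by
  have h0 : (0 : ℂ) = ∫ _ in (0 : ℝ)..1, (0 : ℂ) := by simp
  rw [h0]
  refine intervalIntegral.tendsto_integral_filter_of_dominated_convergence
    (fun _ => Real.exp (1 / 3 + |x|)) ?_ ?_ (by simp) ?_
  · exact Eventually.of_forall fun R =>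
      ((continuous_airyIntegrand x).comp (by fun_prop)).aestronglyMeasurable
  · refine Eventually.of_forall fun R => Eventually.of_forall fun y hy => ?_
    rw [Set.uIoc_of_le zero_le_one] at hy
    rw [norm_airyIntegrand]
    apply Real.exp_le_exp.mpr
    simp only [Complex.ofReal_im, Complex.ofReal_re, mul_zero, sub_zero]
    have h1 : 0 ≤ u R ^ 2 * y := mul_nonneg (sq_nonneg _) hy.1.le
    have h2 : y ^ 3 ≤ 1 := pow_le_one₀ hy.1.le hy.2
    have h3 : -(y * x) ≤ |x| := by
      have := neg_abs_le x
      nlinarith [abs_nonneg x, hy.1, hy.2]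
    linarith
  · refine Eventually.of_forall fun y hy => ?_
    rw [Set.uIoc_of_le zero_le_one] at hy
    rw [tendsto_zero_iff_norm_tendsto_zero]
    simp only [norm_airyIntegrand, hu, Complex.ofReal_im, Complex.ofReal_re, mul_zero, sub_zero]
    refine Real.tendsto_exp_atBot.comp ?_
    have h : Tendsto (fun R : ℝ => R ^ 2 * y) atTop atTop :=
      (tendsto_pow_atTop two_ne_zero).atTop_mul_const hy.1
    have h2 := tendsto_atBot_add_const_right atTop (y ^ 3 / 3 - y * x)
      (tendsto_neg_atTop_atBot.comp h)
    refine h2.congr fun R => ?_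
    simp only [Function.comp]
    ring

/-- On the real axis, `Ai(x) = lim_{R → ∞} (2π)⁻¹ ∫_{-R}^{R} e^{i(k³/3 + k x)} dk`. -/
theorem tendsto_airyAi (x : ℝ) :
    Tendsto (fun R : ℝ => (2 * (Real.pi : ℂ))⁻¹ *
      ∫ k in (-R)..R, Complex.exp (Complex.I * ((k : ℂ) ^ 3 / 3 + (k : ℂ) * (x : ℂ))))
      atTop (𝓝 (airyAi x)) := by
  unfold airyAi
  refine Tendsto.const_mul _ ?_
  have h1 := MeasureTheory.intervalIntegral_tendsto_integral (integrable_airyIntegrand x)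
    tendsto_neg_atTop_atBot tendsto_id
  have h2 := (tendsto_airy_side x (u := fun R => R) (fun R => rfl)).const_mul Complex.I
  have h3 := (tendsto_airy_side x (u := fun R => -R) (fun R => by ring)).const_mul Complex.I
  have h4 := (h1.sub h2).add h3
  simp only [mul_zero, sub_zero, add_zero] at h4
  refine h4.congr fun R => ?_
  have hd : DifferentiableOn ℂ (airyIntegrand x)
      (Set.uIcc (-R : ℝ) R ×ℂ Set.uIcc (0 : ℝ) 1) := by
    unfold airyIntegrand
    fun_prop
  have hc := Complex.integral_boundary_rect_eq_zero_of_differentiableOn (airyIntegrand x)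
    (⟨-R, 0⟩ : ℂ) (⟨R, 1⟩ : ℂ) hd
  simp only [Complex.ofReal_zero, zero_mul, add_zero, Complex.ofReal_one, one_mul,
    smul_eq_mul, id] at hc ⊢
  have he : (∫ k in (-R)..R, airyIntegrand x (k : ℂ)) =
      ∫ k in (-R)..R, Complex.exp (Complex.I * ((k : ℂ) ^ 3 / 3 + (k : ℂ) * (x : ℂ))) := rfl
  rw [← he]
  linear_combination -hc

/-! For `Re η > 0`, move the Airy contour to the horizontal line `s = u + iη` through the saddle
`iη`. The exponent becomes `-2η³/3 - ηu² + iu³/3`, so `e^{2η³/3} Ai(η²)` is a Gaussian integral of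
`e^{iu³/3}` (`airyAi_sq_mul_exp`). Taylor expansion of `e^{iu³/3}` to order `2N` kills the odd
moments. The even ones, times `√η`, are multiples of `η^{-3k}`, that is, of powers of `z = ζ⁻¹`. The
remainder is controlled by the Gaussian moment of order `6N`, uniformly where `κ|η| ≤ Re η`
(`exists_norm_airyAmplitude_sub_sum_le`).

On `S` the cube root has `arg η = -arg z / 3` in `(-π/2, π/6)`, so `Re η > 0` and `J` is the
amplitude composed with this branch. Only the upper edge of `S` reaches `Re η = 0`, which is why `δ`
is removed there and not at the lower edge.

Derivatives follow from Cauchy's estimate on discs of radius proportional to `|z|`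
(`exists_norm_iteratedDeriv_airyAmplitude_sub_le`). Such a disc may cross the cut below the lower
edge, but the amplitude continues analytically there along a local branch of `η`. -/

/-! ### Contour shift to the saddle -/

/-- Completing the square spends half of the decay `e^{-at²}` on the linear term `t Im w`.
Uniformity in the height `y` controls the vertical sides of the rectangle below. -/
theorem norm_airyIntegrand_le_gaussian (w : ℂ) {a b y : ℝ} (ha : 0 < a) (hay : a ≤ y)
    (hyb : y ≤ b) (t : ℝ) :
    ‖airyIntegrand w ((t : ℂ) + (y : ℂ) * Complex.I)‖ ≤
      Real.exp (b ^ 3 / 3 + w.im ^ 2 / (2 * a) + b * |w.re|) *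
        Real.exp (-(a / 2) * t ^ 2) := by
  rw [norm_airyIntegrand, ← Real.exp_add]
  apply Real.exp_le_exp.mpr
  have hy : 0 < y := ha.trans_le hay
  have h1 : t ^ 2 * a ≤ t ^ 2 * y := mul_le_mul_of_nonneg_left hay (sq_nonneg t)
  have h2 : y ^ 3 ≤ b ^ 3 := pow_le_pow_left₀ hy.le hyb 3
  have h3 : -(y * w.re) ≤ b * |w.re| :=
    calc -(y * w.re) = y * -w.re := by ring
      _ ≤ y * |w.re| := mul_le_mul_of_nonneg_left (neg_le_abs _) hy.le
      _ ≤ b * |w.re| := mul_le_mul_of_nonneg_right hyb (abs_nonneg _)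
  have h4 : -(t * w.im) ≤ a / 2 * t ^ 2 + w.im ^ 2 / (2 * a) := by
    have : a / 2 * t ^ 2 + w.im ^ 2 / (2 * a) + t * w.im = (a * t + w.im) ^ 2 / (2 * a) := by
      field_simp
      ring
    have : 0 ≤ (a * t + w.im) ^ 2 / (2 * a) := by positivity
    linarith
  linarith

theorem integrable_airyIntegrand_line (w : ℂ) {y : ℝ} (hy : 0 < y) :
    MeasureTheory.Integrable
      (fun t : ℝ => airyIntegrand w ((t : ℂ) + (y : ℂ) * Complex.I)) := by
  refine MeasureTheory.Integrable.mono' ((integrable_exp_neg_mul_sq (b := y / 2)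
    (by positivity)).const_mul _) ?_
    (Eventually.of_forall (norm_airyIntegrand_le_gaussian w hy le_rfl le_rfl))
  exact ((continuous_airyIntegrand w).comp (by fun_prop)).aestronglyMeasurable

theorem tendsto_airyIntegrand_vertical (w : ℂ) {y : ℝ} (hy : 0 < y) {u : ℝ → ℝ}
    (hu : ∀ R, u R ^ 2 = R ^ 2) :
    Tendsto (fun R : ℝ => ∫ x in (1 : ℝ)..y,
      airyIntegrand w ((u R : ℂ) + (x : ℂ) * Complex.I)) atTop (𝓝 0) := by
  have ha : 0 < min 1 y := lt_min one_pos hy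
  set K := Real.exp ((max 1 y) ^ 3 / 3 + w.im ^ 2 / (2 * min 1 y) + max 1 y * |w.re|)
  have hlim : Tendsto (fun R : ℝ => K * Real.exp (-(min 1 y / 2) * R ^ 2) * |y - 1|)
      atTop (𝓝 0) := by
    have h : Tendsto (fun R : ℝ => -(min 1 y / 2) * R ^ 2) atTop atBot :=
      (tendsto_pow_atTop two_ne_zero).const_mul_atTop_of_neg (by linarith)
    simpa using ((Real.tendsto_exp_atBot.comp h).const_mul K).mul_const |y - 1|
  refine squeeze_zero_norm (fun R => ?_) hlim
  refine intervalIntegral.norm_integral_le_of_norm_le_const fun x hx => ?_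
  have hx' := Set.uIoc_subset_uIcc hx
  rw [← hu R]
  exact norm_airyIntegrand_le_gaussian w ha hx'.1 hx'.2 (u R)

theorem integral_airyIntegrand_line (w : ℂ) {y : ℝ} (hy : 0 < y) :
    ∫ t : ℝ, airyIntegrand w ((t : ℂ) + (y : ℂ) * Complex.I) =
      ∫ t : ℝ, airyIntegrand w ((t : ℂ) + Complex.I) := by
  have h1 := MeasureTheory.intervalIntegral_tendsto_integral (integrable_airyIntegrand w)
    tendsto_neg_atTop_atBot tendsto_id
  have h1' := MeasureTheory.intervalIntegral_tendsto_integral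
    (integrable_airyIntegrand_line w hy) tendsto_neg_atTop_atBot tendsto_id
  have h2 := (tendsto_airyIntegrand_vertical w hy (u := fun R => R)
    (fun R => rfl)).const_mul Complex.I
  have h3 := (tendsto_airyIntegrand_vertical w hy (u := fun R => -R)
    (fun R => by ring)).const_mul Complex.I
  have h4 := (h1.add h2).sub h3
  simp only [mul_zero, sub_zero, add_zero] at h4
  refine tendsto_nhds_unique h1' (h4.congr fun R => ?_)
  have hd : DifferentiableOn ℂ (airyIntegrand w)
      (Set.uIcc (-R : ℝ) R ×ℂ Set.uIcc (1 : ℝ) y) := by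
    unfold airyIntegrand
    fun_prop
  have hc := Complex.integral_boundary_rect_eq_zero_of_differentiableOn (airyIntegrand w)
    (⟨-R, 1⟩ : ℂ) (⟨R, y⟩ : ℂ) hd
  simp only [Complex.ofReal_one, one_mul, smul_eq_mul, id] at hc ⊢
  linear_combination hc

/-- Ai in terms of the integral along the line of steepest descent through the saddle `i η`. -/
theorem airyAi_sq_mul_exp {η : ℂ} (hη : 0 < η.re) :
    Complex.exp (2 * η ^ 3 / 3) * airyAi (η ^ 2) = (2 * (Real.pi : ℂ))⁻¹ *
      ∫ u : ℝ, Complex.exp (-η * (u : ℂ) ^ 2) *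
        Complex.exp (((u ^ 3 / 3 : ℝ) : ℂ) * Complex.I) := by
  -- The point `u + iη` has height `Re η` and abscissa `u - Im η`: a contour shift followed by a
  -- real translation.
  rw [airyAi, ← integral_airyIntegrand_line _ hη,
    ← MeasureTheory.integral_sub_right_eq_self
      (fun t : ℝ => airyIntegrand (η ^ 2) ((t : ℂ) + (η.re : ℂ) * Complex.I)) η.im,
    mul_left_comm, ← MeasureTheory.integral_const_mul]
  congr 2
  ext u
  rw [airyIntegrand, ← Complex.exp_add, ← Complex.exp_add]
  congr 1
  have h : ((u - η.im : ℝ) : ℂ) + (η.re : ℂ) * Complex.I = u + Complex.I * η := by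
    apply Complex.ext <;> simp [sub_eq_add_neg]
  rw [h]
  push_cast
  have h3 : Complex.I ^ 3 = -Complex.I := Complex.I_pow_three
  linear_combination (η * u ^ 2 + η ^ 3 + (Complex.I ^ 2 - 1) * η ^ 3 / 3
    + Complex.I * η ^ 2 * u) * Complex.I_sq

/-! ### Gaussian moments -/

theorem integrable_pow_mul_cexp_neg_mul_sq {η : ℂ} (hη : 0 < η.re) (n : ℕ) :
    MeasureTheory.Integrable
      (fun u : ℝ => (u : ℂ) ^ n * Complex.exp (-η * (u : ℂ) ^ 2)) := by
  have h := integrable_rpow_mul_exp_neg_mul_sq hη (s := n)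
    (by linarith [n.cast_nonneg (α := ℝ)])
  refine (MeasureTheory.integrable_norm_iff (by fun_prop)).1 (h.norm.congr ?_)
  refine Eventually.of_forall fun u => ?_
  simp [Complex.norm_exp, ← Complex.ofReal_pow]

/-- The derivative of `u^{n+1} e^{-ηu²}` integrates to zero. -/
theorem integral_pow_add_two_mul_cexp_neg_mul_sq {η : ℂ} (hη : 0 < η.re) (n : ℕ) :
    ∫ u : ℝ, (u : ℂ) ^ (n + 2) * Complex.exp (-η * (u : ℂ) ^ 2) =
      (n + 1) / (2 * η) * ∫ u : ℝ, (u : ℂ) ^ n * Complex.exp (-η * (u : ℂ) ^ 2) := by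
  have hη0 : η ≠ 0 := by rintro rfl; simp at hη
  have hd (x : ℝ) : HasDerivAt (fun u : ℝ => (u : ℂ) ^ (n + 1) * Complex.exp (-η * (u : ℂ) ^ 2))
      ((n + 1) * ((x : ℂ) ^ n * Complex.exp (-η * (x : ℂ) ^ 2)) -
        2 * η * ((x : ℂ) ^ (n + 2) * Complex.exp (-η * (x : ℂ) ^ 2))) x := by
    have h : HasDerivAt (fun u : ℂ => u ^ (n + 1) * Complex.exp (-η * u ^ 2))
        ((n + 1) * ((x : ℂ) ^ n * Complex.exp (-η * (x : ℂ) ^ 2)) -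
        2 * η * ((x : ℂ) ^ (n + 2) * Complex.exp (-η * (x : ℂ) ^ 2))) x := by
      convert! (hasDerivAt_pow (n + 1) (x : ℂ)).mul
        ((hasDerivAt_pow 2 (x : ℂ)).const_mul (-η)).cexp using 1
      push_cast
      simp
      ring
    exact h.comp_ofReal
  have h1 := (integrable_pow_mul_cexp_neg_mul_sq hη n).const_mul (n + 1 : ℂ)
  have h2 := (integrable_pow_mul_cexp_neg_mul_sq hη (n + 2)).const_mul (2 * η)
  have h := MeasureTheory.integral_eq_zero_of_hasDerivAt_of_integrable hd (h1.sub h2)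
    (integrable_pow_mul_cexp_neg_mul_sq hη (n + 1))
  rw [MeasureTheory.integral_sub h1 h2, MeasureTheory.integral_const_mul,
    MeasureTheory.integral_const_mul] at h
  rw [div_mul_eq_mul_div, eq_div_iff (mul_ne_zero two_ne_zero hη0)]
  linear_combination -h

theorem integral_odd_pow_mul_cexp_neg_mul_sq (η : ℂ) {n : ℕ} (hn : Odd n) :
    ∫ u : ℝ, (u : ℂ) ^ n * Complex.exp (-η * (u : ℂ) ^ 2) = 0 := by
  have h := MeasureTheory.integral_neg_eq_self
    (fun u : ℝ => (u : ℂ) ^ n * Complex.exp (-η * (u : ℂ) ^ 2)) MeasureTheory.volume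
  simp only [Complex.ofReal_neg, hn.neg_pow, even_two.neg_pow, neg_mul,
    MeasureTheory.integral_neg] at h
  have h2 := self_eq_neg.1 h.symm
  simpa using h2

/-- The Gaussian moment of order `2k`, up to the factor `√π η^{-k-1/2}`. -/
noncomputable def gaussianMomentCoeff (k : ℕ) : ℂ :=
  ∏ j ∈ Finset.range k, ((2 * j + 1) / 2 : ℂ)

theorem sqrt_mul_integral_even_pow_mul_cexp_neg_mul_sq {η : ℂ} (hη : 0 < η.re) (k : ℕ) :
    η ^ (1 / 2 : ℂ) * ∫ u : ℝ, (u : ℂ) ^ (2 * k) * Complex.exp (-η * (u : ℂ) ^ 2) =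
      (Real.pi : ℂ) ^ (1 / 2 : ℂ) * gaussianMomentCoeff k * η⁻¹ ^ k := by
  have hη0 : η ≠ 0 := by rintro rfl; simp at hη
  induction k with
  | zero =>
    -- Needed for `log η⁻¹ = -log η`, so that the principal roots of `η` and `π/η` multiply to that
    -- of `π`.
    have harg : η.arg ≠ Real.pi := by
      intro h
      have := Complex.abs_arg_lt_pi_div_two_iff.2 (Or.inl hη)
      rw [h, abs_of_pos Real.pi_pos] at this
      linarith [Real.pi_pos]
    simp only [mul_zero, pow_zero, one_mul, integral_gaussian_complex hη, gaussianMomentCoeff,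
      Finset.range_zero, Finset.prod_empty, mul_one]
    have hπ : (Real.pi : ℂ) ≠ 0 := by exact_mod_cast Real.pi_ne_zero
    rw [Complex.cpow_def_of_ne_zero hη0, Complex.cpow_def_of_ne_zero (div_ne_zero hπ hη0),
      Complex.cpow_def_of_ne_zero hπ, ← Complex.exp_add, div_eq_mul_inv (Real.pi : ℂ) η,
      Complex.log_ofReal_mul Real.pi_pos (inv_ne_zero hη0), Complex.log_inv _ harg,
      Complex.ofReal_log Real.pi_pos.le]
    congr 1
    ring
  | succ k ih =>
    rw [mul_add, mul_one, integral_pow_add_two_mul_cexp_neg_mul_sq hη, mul_left_comm, ih,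
      gaussianMomentCoeff, gaussianMomentCoeff, Finset.prod_range_succ, pow_succ]
    push_cast
    field_simp

/-! ### Taylor expansion of the cubic phase and its remainder -/

/-- The derivative of each remainder is `i` times the preceding one, so the mean value inequality
gains a factor `|x|` per step. The missing `1/n!` is immaterial here. -/
theorem norm_cexp_mul_I_sub_sum_le (n : ℕ) (x : ℝ) :
    ‖Complex.exp (x * Complex.I) -
      ∑ k ∈ Finset.range n, ((x : ℂ) * Complex.I) ^ k / (k.factorial : ℂ)‖ ≤ |x| ^ n := by
  induction n generalizing x with
  | zero => simp [Complex.norm_exp_ofReal_mul_I]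
  | succ n ih =>
    have hd (y : ℝ) : HasDerivAt (fun x : ℝ => Complex.exp (x * Complex.I) -
        ∑ k ∈ Finset.range (n + 1), ((x : ℂ) * Complex.I) ^ k / (k.factorial : ℂ))
        (Complex.I * (Complex.exp (y * Complex.I) -
        ∑ k ∈ Finset.range n, ((y : ℂ) * Complex.I) ^ k / (k.factorial : ℂ))) y := by
      have hl : HasDerivAt (fun x : ℝ => (x : ℂ) * Complex.I) Complex.I y := by
        simpa using (Complex.ofRealCLM.hasDerivAt (x := y)).mul_const Complex.I
      convert! hl.cexp.sub (HasDerivAt.fun_sum fun k _ => (hl.fun_pow k).div_const (k.factorial : ℂ)) using 1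
      rw [Finset.sum_range_succ', mul_sub, mul_comm Complex.I, Finset.mul_sum]
      simp only [Nat.cast_zero, zero_mul, zero_div, add_zero, Nat.add_sub_cancel]
      congr 1
      refine Finset.sum_congr rfl fun k _ => ?_
      have : (k.factorial : ℂ) ≠ 0 := by exact_mod_cast k.factorial_ne_zero
      have : (k + 1 : ℂ) ≠ 0 := by exact_mod_cast k.succ_ne_zero
      rw [Nat.factorial_succ]
      push_cast
      field_simp
    have h := (convex_uIcc (0 : ℝ) x).norm_image_sub_le_of_norm_hasDerivWithin_le
      (C := |x| ^ n) (fun y _ => (hd y).hasDerivWithinAt) (fun y hy => ?_)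
      Set.left_mem_uIcc Set.right_mem_uIcc
    · have h0 : Complex.exp ((0 : ℝ) * Complex.I) - ∑ k ∈ Finset.range (n + 1),
          (((0 : ℝ) : ℂ) * Complex.I) ^ k / (k.factorial : ℂ) = 0 := by
        simp [Finset.sum_range_succ']
      rw [h0, sub_zero, sub_zero, Real.norm_eq_abs, ← pow_succ] at h
      exact h
    · rw [norm_mul, Complex.norm_I, one_mul]
      refine (ih y).trans (pow_le_pow_left₀ (abs_nonneg _) ?_ n)
      simpa using Set.abs_sub_left_of_mem_uIcc hy

/-- `√η e^{2η³/3} Ai(η²)`. -/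
noncomputable def airyAmplitude (η : ℂ) : ℂ :=
  η ^ (1 / 2 : ℂ) * Complex.exp (2 * η ^ 3 / 3) * airyAi (η ^ 2)

/-- The coefficients of the asymptotic expansion of `airyAmplitude η` in powers of
`(2η³/3)⁻¹`. -/
noncomputable def airyCoeff (k : ℕ) : ℂ :=
  (2 * (Real.pi : ℂ))⁻¹ * (Real.pi : ℂ) ^ (1 / 2 : ℂ) * ((Complex.I / 3) ^ (2 * k) /
    ((2 * k).factorial : ℂ)) * gaussianMomentCoeff (3 * k) * (2 / 3) ^ k

theorem cexp_neg_mul_sq_mul_cubic_pow (η : ℂ) (n : ℕ) (u : ℝ) :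
    Complex.exp (-η * (u : ℂ) ^ 2) *
      ((((u ^ 3 / 3 : ℝ) : ℂ) * Complex.I) ^ n / (n.factorial : ℂ)) =
    (Complex.I / 3) ^ n / (n.factorial : ℂ) *
      ((u : ℂ) ^ (3 * n) * Complex.exp (-η * (u : ℂ) ^ 2)) := by
  push_cast
  rw [pow_mul, div_mul_eq_mul_div, mul_div_assoc, mul_pow]
  ring

theorem integrable_cexp_neg_mul_sq_mul_cubic_sum {η : ℂ} (hη : 0 < η.re) (N : ℕ) :
    MeasureTheory.Integrable (fun u : ℝ => Complex.exp (-η * (u : ℂ) ^ 2) *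
      ∑ n ∈ Finset.range N, (((u ^ 3 / 3 : ℝ) : ℂ) * Complex.I) ^ n / (n.factorial : ℂ)) := by
  simp_rw [Finset.mul_sum, cexp_neg_mul_sq_mul_cubic_pow]
  exact MeasureTheory.integrable_finsetSum _ fun n _ =>
    (integrable_pow_mul_cexp_neg_mul_sq hη _).const_mul _

theorem sum_airyCoeff_mul_pow {η : ℂ} (hη : 0 < η.re) (N : ℕ) :
    ∑ k ∈ Finset.range N, airyCoeff k * (2 * η ^ 3 / 3)⁻¹ ^ k =
      (2 * (Real.pi : ℂ))⁻¹ * (η ^ (1 / 2 : ℂ) * ∫ u : ℝ, Complex.exp (-η * (u : ℂ) ^ 2) *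
        ∑ n ∈ Finset.range (2 * N),
          (((u ^ 3 / 3 : ℝ) : ℂ) * Complex.I) ^ n / (n.factorial : ℂ)) := by
  have hη0 : η ≠ 0 := by rintro rfl; simp at hη
  simp_rw [Finset.mul_sum, cexp_neg_mul_sq_mul_cubic_pow]
  rw [MeasureTheory.integral_finsetSum _ fun n _ =>
    (integrable_pow_mul_cexp_neg_mul_sq hη _).const_mul _]
  simp_rw [MeasureTheory.integral_const_mul]
  induction N with
  | zero => simp
  | succ N ih =>
    -- Each new power of `ζ⁻¹` costs two Taylor terms: the even one gives the moment of order `6N`,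
    -- the odd one vanishes.
    have hodd : Odd (3 * (2 * N + 1)) := Odd.mul (by decide) (odd_two_mul_add_one N)
    have h := sqrt_mul_integral_even_pow_mul_cexp_neg_mul_sq hη (3 * N)
    rw [mul_left_comm] at h
    rw [Finset.sum_range_succ, ih, show 2 * (N + 1) = 2 * N + 1 + 1 by ring,
      Finset.sum_range_succ, Finset.sum_range_succ,
      integral_odd_pow_mul_cexp_neg_mul_sq η hodd, mul_zero, add_zero, mul_add, mul_add,
      mul_left_comm (η ^ (1 / 2 : ℂ)), h, airyCoeff]
    have h2 : (2 / 3 : ℂ) ^ N * (2 * η ^ 3 / 3)⁻¹ ^ N = η⁻¹ ^ (3 * N) := by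
      rw [← mul_pow, pow_mul]
      congr 1
      field_simp
    rw [← h2]
    ring

theorem airyAmplitude_sub_sum_eq {η : ℂ} (hη : 0 < η.re) (N : ℕ) :
    airyAmplitude η - ∑ k ∈ Finset.range N, airyCoeff k * (2 * η ^ 3 / 3)⁻¹ ^ k =
      (2 * (Real.pi : ℂ))⁻¹ * (η ^ (1 / 2 : ℂ) * ∫ u : ℝ, Complex.exp (-η * (u : ℂ) ^ 2) *
        (Complex.exp (((u ^ 3 / 3 : ℝ) : ℂ) * Complex.I) - ∑ n ∈ Finset.range (2 * N),
          (((u ^ 3 / 3 : ℝ) : ℂ) * Complex.I) ^ n / (n.factorial : ℂ))) := by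
  have hi : MeasureTheory.Integrable (fun u : ℝ => Complex.exp (-η * (u : ℂ) ^ 2) *
      Complex.exp (((u ^ 3 / 3 : ℝ) : ℂ) * Complex.I)) := by
    refine (integrable_cexp_neg_mul_sq hη).mul_bdd (c := 1) (by fun_prop)
      (Eventually.of_forall fun u => ?_)
    rw [Complex.norm_exp_ofReal_mul_I]
  simp_rw [mul_sub]
  rw [MeasureTheory.integral_sub hi (integrable_cexp_neg_mul_sq_mul_cubic_sum hη _),
    sum_airyCoeff_mul_pow hη, airyAmplitude, mul_assoc, airyAi_sq_mul_exp hη]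
  ring

/-- Norms of the complex moment formula at real `η = a`; this evaluates the majorant of the
remainder. -/
theorem sqrt_mul_integral_even_pow_mul_exp_neg_mul_sq {a : ℝ} (ha : 0 < a) (k : ℕ) :
    a ^ (1 / 2 : ℝ) * ∫ u : ℝ, u ^ (2 * k) * Real.exp (-a * u ^ 2) =
      ‖(Real.pi : ℂ) ^ (1 / 2 : ℂ) * gaussianMomentCoeff k‖ * a⁻¹ ^ k := by
  have h := congrArg (‖·‖) (sqrt_mul_integral_even_pow_mul_cexp_neg_mul_sq (η := a)
    (by simpa using ha) k)
  have h1 : ∫ u : ℝ, (u : ℂ) ^ (2 * k) * Complex.exp (-(a : ℂ) * (u : ℂ) ^ 2) =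
      ((∫ u : ℝ, u ^ (2 * k) * Real.exp (-a * u ^ 2) : ℝ) : ℂ) := by
    rw [← integral_complex_ofReal]
    congr 1
    ext u
    push_cast
    rfl
  have h2 : 0 ≤ ∫ u : ℝ, u ^ (2 * k) * Real.exp (-a * u ^ 2) :=
    MeasureTheory.integral_nonneg fun u =>
      mul_nonneg (Even.pow_nonneg (even_two_mul k) u) (Real.exp_pos _).le
  simp only [h1, norm_mul, norm_pow, norm_inv, Complex.norm_real, Real.norm_of_nonneg h2,
    Complex.norm_cpow_eq_rpow_re_of_pos ha, Real.norm_of_nonneg ha.le] at h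
  rw [norm_mul, ← h]
  norm_num

theorem exists_norm_airyAmplitude_sub_sum_le {κ : ℝ} (hκ : 0 < κ) (N : ℕ) :
    ∃ K : ℝ, 0 ≤ K ∧ ∀ η : ℂ, η ≠ 0 → κ * ‖η‖ ≤ η.re →
      ‖airyAmplitude η - ∑ k ∈ Finset.range N, airyCoeff k * (2 * η ^ 3 / 3)⁻¹ ^ k‖ ≤
        K * ‖(2 * η ^ 3 / 3)⁻¹‖ ^ N := by
  set C := ‖(Real.pi : ℂ) ^ (1 / 2 : ℂ) * gaussianMomentCoeff (3 * N)‖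
  -- The powers of `κ⁻¹` come from trading `|η|` and `Re η` in `√η` and in the moment; `(2/3)^N`
  -- converts `|η|^{-3N}` to `|ζ⁻¹|^N`.
  refine ⟨(2 * Real.pi)⁻¹ * (κ⁻¹ ^ (1 / 2 : ℝ) * (C * κ⁻¹ ^ (3 * N))) * (2 / 3) ^ N,
    by positivity, fun η hη0 hη => ?_⟩
  have hn : 0 < ‖η‖ := norm_pos_iff.2 hη0
  have ha : 0 < η.re := (mul_pos hκ hn).trans_le hη
  have hI : ‖∫ u : ℝ, Complex.exp (-η * (u : ℂ) ^ 2) *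
        (Complex.exp (((u ^ 3 / 3 : ℝ) : ℂ) * Complex.I) - ∑ n ∈ Finset.range (2 * N),
          (((u ^ 3 / 3 : ℝ) : ℂ) * Complex.I) ^ n / (n.factorial : ℂ))‖ ≤
      ∫ u : ℝ, u ^ (2 * (3 * N)) * Real.exp (-η.re * u ^ 2) := by
    have hint : MeasureTheory.Integrable
        (fun u : ℝ => u ^ (2 * (3 * N)) * Real.exp (-η.re * u ^ 2)) := by
      have := integrable_rpow_mul_exp_neg_mul_sq ha (s := (2 * (3 * N) : ℕ))
        (by linarith [(2 * (3 * N)).cast_nonneg (α := ℝ)])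
      simpa only [Real.rpow_natCast] using this
    refine MeasureTheory.norm_integral_le_of_norm_le hint (Eventually.of_forall fun u => ?_)
    rw [norm_mul, norm_cexp_neg_mul_sq, mul_comm]
    refine mul_le_mul_of_nonneg_right ((norm_cexp_mul_I_sub_sum_le _ _).trans ?_)
      (Real.exp_pos _).le
    have hu : u ^ (2 * (3 * N)) = ((u ^ 3) ^ 2) ^ N := by ring
    rw [pow_mul, sq_abs, hu]
    exact pow_le_pow_left₀ (sq_nonneg _) (by linarith [sq_nonneg (u ^ 3)]) N
  have hη' : ‖η‖ ≤ κ⁻¹ * η.re := by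
    rw [inv_mul_eq_div, le_div_iff₀ hκ]
    linarith
  have hs : ‖η ^ (1 / 2 : ℂ)‖ ≤ κ⁻¹ ^ (1 / 2 : ℝ) * η.re ^ (1 / 2 : ℝ) := by
    rw [← Real.mul_rpow (by positivity) ha.le]
    have h := Complex.norm_cpow_real η (1 / 2)
    push_cast at h
    rw [h]
    exact Real.rpow_le_rpow hn.le hη' (by norm_num)
  have hp : η.re⁻¹ ^ (3 * N) ≤ κ⁻¹ ^ (3 * N) * ‖η‖⁻¹ ^ (3 * N) := by
    rw [← mul_pow, ← mul_inv]
    exact pow_le_pow_left₀ (by positivity) (inv_anti₀ (by positivity) hη) _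
  have h2 : (2 / 3 : ℝ) ^ N * ‖(2 * η ^ 3 / 3)⁻¹‖ ^ N = ‖η‖⁻¹ ^ (3 * N) := by
    rw [← mul_pow, pow_mul]
    congr 1
    simp
    field_simp
  rw [airyAmplitude_sub_sum_eq ha, norm_mul, norm_mul]
  have hπ : ‖(2 * (Real.pi : ℂ))⁻¹‖ = (2 * Real.pi)⁻¹ := by
    simp [abs_of_pos Real.pi_pos]
  rw [hπ, mul_assoc _ _ (‖_‖ ^ N), h2, mul_assoc]
  refine mul_le_mul_of_nonneg_left ?_ (by positivity)
  calc _ ≤ (κ⁻¹ ^ (1 / 2 : ℝ) * η.re ^ (1 / 2 : ℝ)) *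
        ∫ u : ℝ, u ^ (2 * (3 * N)) * Real.exp (-η.re * u ^ 2) :=
        mul_le_mul hs hI (norm_nonneg _) (by positivity)
    _ = κ⁻¹ ^ (1 / 2 : ℝ) * (C * η.re⁻¹ ^ (3 * N)) := by
        rw [mul_assoc, sqrt_mul_integral_even_pow_mul_exp_neg_mul_sq ha]
    _ ≤ κ⁻¹ ^ (1 / 2 : ℝ) * (C * (κ⁻¹ ^ (3 * N) * ‖η‖⁻¹ ^ (3 * N))) := by gcongr
    _ = _ := by ring

/-! ### The branch of the cube root -/

/-- The solution `η` of `(2η³/3)⁻¹ = z` with `η > 0` for `z > 0`, analytic off the negative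
imaginary half-axis. -/
noncomputable def airyBranch (z : ℂ) : ℂ :=
  Complex.exp (-(Complex.log (2 / 3) + Complex.log (-Complex.I * z) +
    (Real.pi / 2 : ℝ) * Complex.I) / 3)

theorem analyticAt_airyAmplitude {η : ℂ} (hη : 0 < η.re) : AnalyticAt ℂ airyAmplitude η := by
  unfold airyAmplitude
  refine ((analyticAt_id.cpow analyticAt_const (Or.inl hη)).mul ?_).mul ?_
  · fun_prop
  · exact (differentiable_airyAi.analyticAt _).comp (analyticAt_id.pow 2)

theorem analyticAt_airyBranch {z : ℂ} (hz : -Complex.I * z ∈ Complex.slitPlane) :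
    AnalyticAt ℂ airyBranch z := by
  unfold airyBranch
  have h : AnalyticAt ℂ (fun z => Complex.log (-Complex.I * z)) z :=
    (analyticAt_const.mul analyticAt_id).clog hz
  exact ((((analyticAt_const.add h).add analyticAt_const).neg).div analyticAt_const
    (by norm_num)).cexp

theorem airyBranch_cube {z : ℂ} (hz : z ≠ 0) : 2 * airyBranch z ^ 3 / 3 = z⁻¹ := by
  have hz' : -Complex.I * z ≠ 0 := by simp [hz]
  rw [airyBranch, ← Complex.exp_nat_mul]
  have h : ((3 : ℕ) : ℂ) * (-(Complex.log (2 / 3) + Complex.log (-Complex.I * z) +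
      (Real.pi / 2 : ℝ) * Complex.I) / 3) = -(Complex.log (2 / 3) +
      Complex.log (-Complex.I * z) + (Real.pi / 2 : ℂ) * Complex.I) := by
    push_cast
    ring
  rw [h, Complex.exp_neg, Complex.exp_add, Complex.exp_add, Complex.exp_log (by norm_num),
    Complex.exp_log hz', Complex.exp_pi_div_two_mul_I]
  field_simp
  simp

/-- Near `z₀` the difference of the two logarithms has small imaginary part, hence is the principal
`log (z / z₀)`. The right side makes sense on a full disc about `z₀`, even across the cut of
`airyBranch`. -/
theorem eventually_airyBranch_eq {z₀ : ℂ} (hz₀ : -Complex.I * z₀ ∈ Complex.slitPlane) :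
    ∀ᶠ z in 𝓝 z₀, airyBranch z = airyBranch z₀ * Complex.exp (-Complex.log (z / z₀) / 3) := by
  have h0 : -Complex.I * z₀ ≠ 0 := Complex.slitPlane_ne_zero hz₀
  have hc : ContinuousAt (fun z => (Complex.log (-Complex.I * z) -
      Complex.log (-Complex.I * z₀)).im) z₀ :=
    Complex.continuous_im.continuousAt.comp
      (((continuousAt_const.mul continuousAt_id).clog hz₀).sub continuousAt_const)
  have hm : Set.Ioo (-Real.pi) Real.pi ∈ 𝓝 ((Complex.log (-Complex.I * z₀) -
      Complex.log (-Complex.I * z₀)).im) := by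
    rw [sub_self, Complex.zero_im]
    exact Ioo_mem_nhds (neg_neg_of_pos Real.pi_pos) Real.pi_pos
  have hne : ∀ᶠ z in 𝓝 z₀, z ≠ 0 := isOpen_ne.mem_nhds (right_ne_zero_of_mul h0)
  filter_upwards [hc hm, hne] with z hz hz0
  have h : Complex.log (z / z₀) =
      Complex.log (-Complex.I * z) - Complex.log (-Complex.I * z₀) := by
    rw [← Complex.log_exp hz.1 hz.2.le, Complex.exp_sub, Complex.exp_log (by simp [hz0]),
      Complex.exp_log h0, mul_div_mul_left _ _ (by simp)]
  rw [airyBranch, airyBranch, ← Complex.exp_add, h]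
  congr 1
  ring

/-! ### Cauchy estimates for the derivatives -/

theorem exists_perturbation_radius {κ : ℝ} (hκ : 0 < κ) :
    ∃ ε : ℝ, 0 < ε ∧ ε < 1 ∧ ∀ η q : ℂ, κ * ‖η‖ ≤ η.re → ‖q - 1‖ ≤ ε →
      κ / 2 * ‖η * Complex.exp (-Complex.log q / 3)‖ ≤
        (η * Complex.exp (-Complex.log q / 3)).re := by
  -- If `|p - 1|` is at most both bounds, then `Re(ηp) ≥ (3κ/4)|η|` and `|p| ≤ 3/2`, which gives
  -- exactly the ratio `κ/2`.
  have hτ : 0 < min (κ / 4) (1 / 2) := lt_min (by positivity) (by norm_num)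
  have hc : ContinuousAt (fun q => Complex.exp (-Complex.log q / 3)) 1 :=
    Complex.continuous_exp.continuousAt.comp
      ((continuousAt_id.clog Complex.one_mem_slitPlane).neg.div_const 3)
  obtain ⟨ε, hε, h⟩ := Metric.continuousAt_iff.1 hc _ hτ
  refine ⟨min (ε / 2) (1 / 2), by positivity, (min_le_right _ _).trans_lt (by norm_num),
    fun η q hη hq => ?_⟩
  have hp := h (x := q) (by
    rw [dist_eq_norm]
    exact (hq.trans (min_le_left _ _)).trans_lt (by linarith))
  simp only [Complex.log_one, neg_zero, zero_div, Complex.exp_zero, dist_eq_norm] at hp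
  set p := Complex.exp (-Complex.log q / 3)
  have hp1 : ‖p - 1‖ ≤ κ / 4 := hp.le.trans (min_le_left _ _)
  have hp2 : ‖p‖ ≤ 3 / 2 := by
    have := norm_add_le (p - 1) 1
    rw [sub_add_cancel, norm_one] at this
    linarith [hp.le.trans (min_le_right _ _)]
  have hre : η.re - ‖η‖ * (κ / 4) ≤ (η * p).re := by
    have h1 : η * p = η + η * (p - 1) := by ring
    have h2 := (abs_le.1 (Complex.abs_re_le_norm (η * (p - 1)))).1
    have h3 : ‖η * (p - 1)‖ ≤ ‖η‖ * (κ / 4) := by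
      rw [norm_mul]
      exact mul_le_mul_of_nonneg_left hp1 (norm_nonneg _)
    rw [h1, Complex.add_re]
    linarith
  have hn : κ / 2 * ‖η * p‖ ≤ κ / 2 * (‖η‖ * (3 / 2)) := by
    rw [norm_mul]
    gcongr
  linarith

theorem exists_norm_iteratedDeriv_airyAmplitude_sub_le {κ : ℝ} (hκ : 0 < κ) (m N : ℕ) :
    ∃ K : ℝ, ∀ z : ℂ, -Complex.I * z ∈ Complex.slitPlane →
      κ * ‖airyBranch z‖ ≤ (airyBranch z).re →
      ‖iteratedDeriv m (fun u => airyAmplitude (airyBranch u)) z - iteratedDeriv m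
        (fun u : ℂ => ∑ n ∈ Finset.range (N + m), airyCoeff n * u ^ n) z‖ ≤ K * ‖z‖ ^ N := by
  obtain ⟨ε, hε, hε1, hpert⟩ := exists_perturbation_radius hκ
  obtain ⟨K, hK, hbound⟩ := exists_norm_airyAmplitude_sub_sum_le (half_pos hκ) (N + m)
  -- Cauchy's bound `m! sup / (ε|z|)^m` with `sup ≤ K(2|z|)^{N+m}`: the `m` extra terms of the sum
  -- pay for the lost `|z|^m`.
  refine ⟨m.factorial * (K * 2 ^ (N + m)) / ε ^ m, fun z hz hre => ?_⟩
  have hz0 : z ≠ 0 := right_ne_zero_of_mul (Complex.slitPlane_ne_zero hz)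
  have hzn : 0 < ‖z‖ := norm_pos_iff.2 hz0
  -- Local continuation of the branch, analytic on the whole closed disc since `|u/z - 1| ≤ ε < 1`.
  set η : ℂ → ℂ := fun u => airyBranch z * Complex.exp (-Complex.log (u / z) / 3) with hηdef
  have hη0 (u : ℂ) : η u ≠ 0 := mul_ne_zero (Complex.exp_ne_zero _) (Complex.exp_ne_zero _)
  have hq {u : ℂ} (hu : u ∈ Metric.closedBall z (ε * ‖z‖)) : ‖u / z - 1‖ ≤ ε := by
    rw [div_sub_one hz0, norm_div, div_le_iff₀ hzn]
    simpa [dist_eq_norm] using hu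
  have hslit {u : ℂ} (hu : u ∈ Metric.closedBall z (ε * ‖z‖)) :
      u / z ∈ Complex.slitPlane := by
    have := Complex.mem_slitPlane_of_norm_lt_one ((hq hu).trans_lt hε1)
    rwa [add_sub_cancel] at this
  have hηre {u : ℂ} (hu : u ∈ Metric.closedBall z (ε * ‖z‖)) :
      κ / 2 * ‖η u‖ ≤ (η u).re := hpert _ _ hre (hq hu)
  have hηcube {u : ℂ} (hu : u ∈ Metric.closedBall z (ε * ‖z‖)) :
      (2 * η u ^ 3 / 3)⁻¹ = u := by
    have h0 := Complex.slitPlane_ne_zero (hslit hu)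
    have h1 : Complex.exp (-Complex.log (u / z) / 3) ^ 3 = (u / z)⁻¹ := by
      rw [← Complex.exp_nat_mul, ← Complex.exp_log h0, ← Complex.exp_neg, Complex.exp_log h0]
      congr 1
      push_cast
      ring
    have h2 : 2 * η u ^ 3 / 3 = 2 * airyBranch z ^ 3 / 3 * (u / z)⁻¹ := by
      rw [← h1, hηdef]
      ring
    rw [h2, airyBranch_cube hz0, mul_inv, inv_inv, inv_inv, mul_div_cancel₀ _ hz0]
  have hL {u : ℂ} (hu : u ∈ Metric.closedBall z (ε * ‖z‖)) :
      AnalyticAt ℂ (fun u => airyAmplitude (η u)) u := by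
    have hpos : 0 < (η u).re :=
      (mul_pos (half_pos hκ) (norm_pos_iff.2 (hη0 u))).trans_le (hηre hu)
    have hlog : AnalyticAt ℂ (fun u => Complex.log (u / z)) u :=
      (analyticAt_id.div analyticAt_const hz0).clog (hslit hu)
    exact (analyticAt_airyAmplitude hpos).comp
      (analyticAt_const.mul (hlog.neg.div analyticAt_const (by norm_num)).cexp)
  have hP (u : ℂ) : AnalyticAt ℂ
      (fun u : ℂ => ∑ n ∈ Finset.range (N + m), airyCoeff n * u ^ n) u := by fun_prop
  have hzmem : z ∈ Metric.closedBall z (ε * ‖z‖) :=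
    Metric.mem_closedBall_self (by positivity)
  have heq : (fun u => airyAmplitude (airyBranch u)) =ᶠ[𝓝 z] fun u => airyAmplitude (η u) := by
    filter_upwards [eventually_airyBranch_eq hz] with u hu
    rw [hu]
  rw [heq.iteratedDeriv_eq, ← iteratedDeriv_fun_sub (hL hzmem).contDiffAt (hP z).contDiffAt]
  have hdiff : DiffContOnCl ℂ (fun u => airyAmplitude (η u) -
      ∑ n ∈ Finset.range (N + m), airyCoeff n * u ^ n) (Metric.ball z (ε * ‖z‖)) :=
    DifferentiableOn.diffContOnCl_ball (fun u hu =>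
      ((hL hu).sub (hP u)).differentiableAt.differentiableWithinAt) subset_rfl
  refine (Complex.norm_iteratedDeriv_le_of_forall_mem_sphere_norm_le m (by positivity) hdiff
    (C := K * (2 * ‖z‖) ^ (N + m)) fun u hu => ?_).trans_eq ?_
  · have hu' := Metric.sphere_subset_closedBall hu
    have h := hbound (η u) (hη0 u) (hηre hu')
    rw [hηcube hu'] at h
    refine h.trans ?_
    have hun : ‖u‖ ≤ 2 * ‖z‖ := by
      have h1 := norm_add_le (u - z) z
      rw [sub_add_cancel, mem_sphere_iff_norm.1 hu] at h1
      nlinarith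
    gcongr
  · rw [mul_pow, mul_pow, pow_add ‖z‖]
    field_simp

/-! ### The sector in polar coordinates -/

theorem neg_I_mul_polar (r θ : ℝ) :
    -Complex.I * ((r : ℂ) * Complex.exp ((θ : ℂ) * Complex.I)) =
      r * Complex.exp (((θ - Real.pi / 2 : ℝ) : ℂ) * Complex.I) := by
  have h : (((θ - Real.pi / 2 : ℝ) : ℂ) * Complex.I) =
      (θ : ℂ) * Complex.I - Real.pi / 2 * Complex.I := by
    push_cast
    ring
  rw [h, Complex.exp_sub, Complex.exp_pi_div_two_mul_I, div_eq_mul_inv, Complex.inv_I]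
  ring

theorem log_ofReal_mul_exp {r θ : ℝ} (hr : 0 < r) (h1 : -Real.pi < θ) (h2 : θ ≤ Real.pi) :
    Complex.log ((r : ℂ) * Complex.exp ((θ : ℂ) * Complex.I)) =
      Real.log r + (θ : ℂ) * Complex.I := by
  rw [Complex.log_ofReal_mul hr (Complex.exp_ne_zero _),
    Complex.log_exp (by simpa using h1) (by simpa using h2)]

theorem neg_I_mul_mem_slitPlane {z : ℂ}
    (hz : z ∈ sector (-(Real.pi / 2)) (3 * Real.pi / 2)) :
    -Complex.I * z ∈ Complex.slitPlane := by
  obtain ⟨r, θ, hr, h1, h2, rfl⟩ := hz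
  have hne : (r : ℂ) * Complex.exp (((θ - Real.pi / 2 : ℝ) : ℂ) * Complex.I) ≠ 0 :=
    mul_ne_zero (by exact_mod_cast hr.ne') (Complex.exp_ne_zero _)
  rw [neg_I_mul_polar, Complex.mem_slitPlane_iff_arg]
  refine ⟨?_, hne⟩
  rw [← Complex.log_im, log_ofReal_mul_exp hr (by linarith) (by linarith)]
  simp only [Complex.add_im, Complex.ofReal_im, Complex.mul_I_im, Complex.ofReal_re, zero_add]
  linarith

theorem airyBranch_polar {r θ : ℝ} (hr : 0 < r) (h1 : -(Real.pi / 2) < θ)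
    (h2 : θ < 3 * Real.pi / 2) :
    airyBranch ((r : ℂ) * Complex.exp ((θ : ℂ) * Complex.I)) =
      (Real.exp (-(Real.log (2 / 3) + Real.log r) / 3) : ℂ) *
        Complex.exp (((-θ / 3 : ℝ) : ℂ) * Complex.I) := by
  have h : Complex.log (2 / 3) = (Real.log (2 / 3) : ℂ) := by
    rw [Complex.ofReal_log (by norm_num)]
    norm_num
  rw [airyBranch, neg_I_mul_polar, log_ofReal_mul_exp hr (by linarith) (by linarith), h,
    Complex.ofReal_exp, ← Complex.exp_add]
  congr 1
  push_cast
  ring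

theorem exists_mul_norm_airyBranch_le_re {δ : ℝ} (hδ : 0 < δ) :
    ∃ κ : ℝ, 0 < κ ∧ ∀ z ∈ sector (-(Real.pi / 2)) (3 * Real.pi / 2 - δ),
      κ * ‖airyBranch z‖ ≤ (airyBranch z).re := by
  have hπ := Real.pi_pos
  -- `arg η = -θ/3` lies between `-(π/2 - δ/3)` and `π/6`, so `β < π/2` bounds its modulus.
  set β := max (Real.pi / 6) (Real.pi / 2 - δ / 3) with hβ
  have hβ0 : 0 < β := lt_max_of_lt_left (by positivity)
  have hβ1 : β < Real.pi / 2 := max_lt (by linarith) (by linarith)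
  refine ⟨Real.cos β, Real.cos_pos_of_mem_Ioo ⟨by linarith, hβ1⟩, ?_⟩
  rintro z ⟨r, θ, hr, h1, h2, rfl⟩
  rw [airyBranch_polar hr h1 (by linarith), norm_mul, Complex.norm_exp_ofReal_mul_I, mul_one,
    Complex.norm_real, Real.norm_of_nonneg (Real.exp_pos _).le, Complex.re_ofReal_mul,
    Complex.exp_ofReal_mul_I_re, mul_comm]
  refine mul_le_mul_of_nonneg_left ?_ (Real.exp_pos _).le
  rw [← Real.cos_abs (-θ / 3)]
  refine Real.cos_le_cos_of_nonneg_of_le_pi (abs_nonneg _) (by linarith) (abs_le.2 ⟨?_, ?_⟩)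
  · linarith [le_max_right (Real.pi / 6) (Real.pi / 2 - δ / 3)]
  · linarith [le_max_left (Real.pi / 6) (Real.pi / 2 - δ / 3)]

theorem inv_cube_eq_polar {η : ℂ} (hη : η ≠ 0) :
    (2 * η ^ 3 / 3)⁻¹ = ((3 / (2 * ‖η‖ ^ 3) : ℝ) : ℂ) *
      Complex.exp (((-3 * η.arg : ℝ) : ℂ) * Complex.I) := by
  have hn : (‖η‖ : ℂ) ≠ 0 := by exact_mod_cast norm_ne_zero_iff.2 hη
  have h : Complex.exp (((-3 * η.arg : ℝ) : ℂ) * Complex.I) =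
      (Complex.exp (η.arg * Complex.I) ^ 3)⁻¹ := by
    rw [← Complex.exp_nat_mul, ← Complex.exp_neg]
    congr 1
    push_cast
    ring
  have he := Complex.exp_ne_zero (η.arg * Complex.I)
  rw [h]
  conv_lhs => rw [← Complex.norm_mul_exp_arg_mul_I η]
  push_cast
  field_simp

theorem inv_cube_mem_sector {η : ℂ} (hη : η ≠ 0) (h1 : -(Real.pi / 2) < η.arg)
    (h2 : η.arg < Real.pi / 6) :
    (2 * η ^ 3 / 3)⁻¹ ∈ sector (-(Real.pi / 2)) (3 * Real.pi / 2) := by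
  have hn := norm_pos_iff.2 hη
  exact ⟨_, _, by positivity, by linarith, by linarith, inv_cube_eq_polar hη⟩

theorem airyBranch_inv_cube {η : ℂ} (hη : η ≠ 0) (h1 : -(Real.pi / 2) < η.arg)
    (h2 : η.arg < Real.pi / 6) : airyBranch (2 * η ^ 3 / 3)⁻¹ = η := by
  have hn := norm_pos_iff.2 hη
  rw [inv_cube_eq_polar hη, airyBranch_polar (by positivity) (by linarith) (by linarith)]
  conv_rhs => rw [← Complex.norm_mul_exp_arg_mul_I η]
  congr 2
  · have h : Real.log (2 / 3) + Real.log (3 / (2 * ‖η‖ ^ 3)) = -(3 * Real.log ‖η‖) := by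
      rw [← Real.log_mul (by norm_num) (by positivity)]
      have : (2 / 3 : ℝ) * (3 / (2 * ‖η‖ ^ 3)) = (‖η‖ ^ 3)⁻¹ := by field_simp
      rw [this, Real.log_inv, Real.log_pow]
      norm_num
    rw [h, neg_neg, mul_div_cancel_left₀ _ (by norm_num), Real.exp_log hn]
  · congr 2
    ring

/-! ### The expansion at the origin -/

theorem iteratedDeriv_sum_mul_pow_zero (c : ℕ → ℂ) (m : ℕ) :
    iteratedDeriv m (fun u : ℂ => ∑ n ∈ Finset.range (1 + m), c n * u ^ n) 0 =
      m.factorial * c m := by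
  rw [iteratedDeriv_fun_sum fun n _ => by fun_prop, Finset.sum_eq_single m]
  · rw [iteratedDeriv_const_mul_field, iteratedDeriv_fun_pow_zero, if_pos rfl, mul_comm]
  · intro n _ hn
    rw [iteratedDeriv_const_mul_field, iteratedDeriv_fun_pow_zero, if_neg hn.symm]
    simp
  · simp

theorem sector_subset_sector_sub {a b δ : ℝ} (hδ : 0 < δ) :
    sector a (b - δ) ⊆ sector a b := by
  rintro z ⟨r, θ, hr, h1, h2, rfl⟩
  exact ⟨r, θ, hr, h1, by linarith, rfl⟩

theorem isBigO_iteratedDeriv_airyAmplitude_sub {δ : ℝ} (hδ : 0 < δ) (m N : ℕ) :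
    (fun z : ℂ => iteratedDeriv m (fun u => airyAmplitude (airyBranch u)) z -
      iteratedDeriv m (fun u : ℂ => ∑ n ∈ Finset.range (N + m), airyCoeff n * u ^ n) z)
      =O[𝓝[sector (-(Real.pi / 2)) (3 * Real.pi / 2 - δ)] 0] (fun z : ℂ => z ^ N) := by
  obtain ⟨κ, hκ, hre⟩ := exists_mul_norm_airyBranch_le_re hδ
  obtain ⟨K, hK⟩ := exists_norm_iteratedDeriv_airyAmplitude_sub_le hκ m N
  refine Asymptotics.IsBigO.of_bound K ?_
  filter_upwards [self_mem_nhdsWithin] with z hz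
  rw [norm_pow]
  exact hK z (neg_I_mul_mem_slitPlane (sector_subset_sector_sub hδ hz)) (hre z hz)

theorem mainTheorem12 :
    ∃ J : ℂ → ℂ,
      AnalyticOnNhd ℂ J (sector (-(Real.pi / 2)) (3 * Real.pi / 2)) ∧
      (∀ η : ℂ, η ≠ 0 → -(Real.pi / 2) < η.arg → η.arg < Real.pi / 6 →
        (2 * η ^ 3 / 3)⁻¹ ∈ sector (-(Real.pi / 2)) (3 * Real.pi / 2) ∧
        J (2 * η ^ 3 / 3)⁻¹ =
          η ^ (1 / 2 : ℂ) * Complex.exp (2 * η ^ 3 / 3) * airyAi (η ^ 2)) ∧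
      ∃ c : ℕ → ℂ, ∀ δ : ℝ, 0 < δ → ∀ m : ℕ,
        Tendsto (iteratedDeriv m J)
          (𝓝[sector (-(Real.pi / 2)) (3 * Real.pi / 2 - δ)] 0)
          (𝓝 ((m.factorial : ℂ) * c m)) ∧
        ∀ N : ℕ,
          (fun z : ℂ => iteratedDeriv m J z -
            iteratedDeriv m (fun u : ℂ => ∑ n ∈ Finset.range (N + m), c n * u ^ n) z)
            =O[𝓝[sector (-(Real.pi / 2)) (3 * Real.pi / 2 - δ)] 0] (fun z : ℂ => z ^ N) := by
  refine ⟨fun z => airyAmplitude (airyBranch z), ?_, fun η hη h1 h2 =>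
    ⟨inv_cube_mem_sector hη h1 h2, ?_⟩, airyCoeff, fun δ hδ m =>
    ⟨?_, isBigO_iteratedDeriv_airyAmplitude_sub hδ m⟩⟩
  · rintro z ⟨r, θ, hr, h1, h2, rfl⟩
    refine (analyticAt_airyAmplitude ?_).comp
      (analyticAt_airyBranch (neg_I_mul_mem_slitPlane ⟨r, θ, hr, h1, h2, rfl⟩))
    rw [airyBranch_polar hr h1 h2, Complex.re_ofReal_mul, Complex.exp_ofReal_mul_I_re]
    exact mul_pos (Real.exp_pos _) (Real.cos_pos_of_mem_Ioo ⟨by linarith, by linarith⟩)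
  · simp only [airyBranch_inv_cube hη h1 h2, airyAmplitude]
  -- The limit (i) is the case `N = 1` of (ii): the error is `O(z)`, and the `m`-th derivative of
  -- the polynomial tends to `m! c_m`.
  · have h1 : Tendsto (fun z : ℂ => z ^ 1)
        (𝓝[sector (-(Real.pi / 2)) (3 * Real.pi / 2 - δ)] 0) (𝓝 0) := by
      simp only [pow_one]
      exact tendsto_nhdsWithin_of_tendsto_nhds tendsto_id
    have h2 := (isBigO_iteratedDeriv_airyAmplitude_sub hδ m 1).trans_tendsto h1
    have h3 : Continuous (iteratedDeriv m
        (fun u : ℂ => ∑ n ∈ Finset.range (1 + m), airyCoeff n * u ^ n)) :=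
      ContDiff.continuous_iteratedDeriv (n := m) m (by fun_prop) le_rfl
    have h4 := h2.add ((h3.tendsto 0).mono_left nhdsWithin_le_nhds)
    rw [iteratedDeriv_sum_mul_pow_zero, zero_add] at h4
    simpa using h4
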